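/- Let $A\ge 2$ be an integer, let $w(0),\dots,w(A-1)>0$, let $\theta_L>0$ $(L\in\mathbb N)$, and define weights $w_L(n)=w(n)$ for $0\le n<A$ and $w_L(n)=1/\theta_L$ for $n\ge A$. (These are, with the constant $w(A-1)$ absorbed into $\theta_L$, the stationary weights $\prod_{k=1}^n 1/g_L(k)$ of a zero-range process with jump rates $g_L(n)=g(n)>0$ for $1\le n<A$, a fast rate proportional to $\theta_L$ at $n=A$, and $g_L(n)=1$ for $n>A$.) For a finite lattice $\Lambda$ with $|\Lambda|=L\ge1$ sites and $N\in\mathbb N_0$ particles, the canonical measure is the probability measure $$\pi_{L,N}[\eta]=\frac1{Z_{L,N}}\prod_{x\in\Lambda}w_L(\eta_x),\qquad \eta\in E_{L,N}=\Big\{\eta\in\mathbb N_0^{\Lambda}:\sum_{x\in\Lambda}\eta_x=N\Big\},\qquad Z_{L,N}=\sum_{\eta\in E_{L,N}}\prod_{x\in\Lambda}w_L(\eta_x).$$ Put $$z(\phi)=\sum_{n=0}^{A-1}w(n)\phi^n,\qquad R(\phi)=\frac1{z(\phi)}\sum_{n=1}^{A-1}n\,w(n)\phi^n,\qquad \rho_c=R(1)=\frac{\sum_{n=1}^{A-1}n\,w(n)}{\sum_{n=0}^{A-1}w(n)},$$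 and for $\phi\ge0$ let $\nu_\phi$ be the probability measure on $\{0,\dots,A-1\}$ with $\nu_\phi[k]=w(k)\phi^k/z(\phi)$. Consider the thermodynamic limit $L,N\to\infty$ with $N/L\to\rho>0$ and $\theta_L/L^\gamma\to\Theta>0$ for some $\gamma>0$. Then the system exhibits a condensation transition with critical density $\rho_c$, in the following sense. Let $m\in\mathbb N_0$ be fixed and let $x_1,\dots,x_m\in\Lambda$ be distinct sites (for $L$ large enough). (i) If $\rho\le\rho_c$, there is a unique $\phi\ge0$ with $R(\phi)=\rho$; it satisfies $\phi\le1$, and under $\pi_{L,N}$ the vector $(\eta_{x_1},\dots,\eta_{x_m})$ converges in distribution to $m$ iid random variables with law $\nu_\phi$. (ii) If $\rho\ge\rho_c$, then under $\pi_{L,N}$ the vector $(\eta_{x_1},\dots,\eta_{x_m})$ converges in distribution to $m$ iid random variables with law $\nu_1$, i.e. $\nu_1[k]=w(k)/(w(0)+\dots+w(A-1))$ for $0\le k\le A-1$. The mean of $\nu_1$, the bulk density, is $\rho_c$. -/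

import Mathlib

open Filter Topology MeasureTheory ProbabilityTheory
open scoped ENNReal

namespace ZRP

/-- The jump rates `g_L` of the zero-range process: `g n` for `1 ≤ n < A`, a fast rate `r` at
occupation number `A`, and `1` above `A`. -/
noncomputable def jumpRate (g : ℕ → ℝ) (A : ℕ) (r : ℝ) (n : ℕ) : ℝ :=
  if n = 0 then 0 else if n < A then g n else if n = A then r else 1

/-- The stationary weights `∏_{k=1}^n 1 / g k` of the zero-range process with jump rates `g`. -/
noncomputable def stationaryWeight (g : ℕ → ℝ) (n : ℕ) : ℝ :=
  ∏ k ∈ Finset.Icc 1 n, (g k)⁻¹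

/-- The size-dependent weights `w_L`: they agree with `w` below `A` and equal `1 / θ` from
`A` on. -/
noncomputable def sizeWeight (w : ℕ → ℝ) (A : ℕ) (θ : ℝ) (n : ℕ) : ℝ :=
  if n < A then w n else 1 / θ

/-- The stationary weights of the zero-range process with a fast rate at `A` are of the form
`sizeWeight`; the constant factor `w (A - 1)` is absorbed into the parameter `θ`. -/
theorem stationaryWeight_jumpRate (g : ℕ → ℝ) {A : ℕ} (hA : 2 ≤ A)
    (hg : ∀ n, 1 ≤ n → n < A → 0 < g n) (r : ℝ) (n : ℕ) :
    stationaryWeight (jumpRate g A r) n =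
      sizeWeight (stationaryWeight g) A (r / stationaryWeight g (A - 1)) n := by
  have low : ∀ n, n < A → stationaryWeight (jumpRate g A r) n = stationaryWeight g n := by
    intro n hn
    refine Finset.prod_congr rfl fun k hk => ?_
    have hk' := Finset.mem_Icc.1 hk
    have h0 : k ≠ 0 := by omega
    have h1 : k < A := by omega
    simp [jumpRate, h0, h1]
  by_cases hn : n < A
  · simp [sizeWeight, hn, low n hn]
  · have hn' : A ≤ n := not_lt.1 hn
    simp only [sizeWeight, hn, if_false, one_div_div]
    induction n, hn' using Nat.le_induction with
    | base =>
      obtain ⟨B, rfl⟩ : ∃ B, A = B + 1 := ⟨A - 1, by omega⟩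
      have := low B (by omega)
      unfold stationaryWeight at this ⊢
      rw [Finset.prod_Icc_succ_top (by omega), this]
      simp [jumpRate, div_eq_mul_inv]
    | succ n hle ih =>
      have := ih (by omega)
      unfold stationaryWeight at this ⊢
      rw [Finset.prod_Icc_succ_top (by omega), this]
      have h1 : ¬ n + 1 < A := by omega
      have h2 : n + 1 ≠ A := by omega
      simp [jumpRate, h1, h2]

theorem sizeWeight_pos {w : ℕ → ℝ} {A : ℕ} {θ : ℝ} (hw : ∀ n, n < A → 0 < w n) (hθ : 0 < θ)
    (n : ℕ) : 0 < sizeWeight w A θ n := by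
  unfold sizeWeight
  split_ifs with h
  · exact hw n h
  · positivity

section Canonical

open Classical in
/-- The set `E_{L,N}` of configurations of `N` particles on the lattice `Λ`. -/
noncomputable def configs (Λ : Type*) [Fintype Λ] (N : ℕ) : Finset (Λ → ℕ) :=
  Finset.piAntidiag Finset.univ N

theorem mem_configs {Λ : Type*} [Fintype Λ] {N : ℕ} {η : Λ → ℕ} :
    η ∈ configs Λ N ↔ ∑ x, η x = N := by
  simp [configs, Finset.mem_piAntidiag]

/-- The canonical partition function `Z_{L,N}`. -/
noncomputable def partitionFunction (w : ℕ → ℝ) (Λ : Type*) [Fintype Λ] (N : ℕ) : ℝ :=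
  ∑ η ∈ configs Λ N, ∏ x, w (η x)

theorem partitionFunction_pos {w : ℕ → ℝ} (hw : ∀ n, 0 < w n) (Λ : Type*) [Fintype Λ]
    [Nonempty Λ] (N : ℕ) : 0 < partitionFunction w Λ N := by
  classical
  refine Finset.sum_pos (fun η _ => Finset.prod_pos fun x _ => hw _) ?_
  exact ⟨Pi.single (Classical.arbitrary Λ) N, mem_configs.2 (by simp)⟩

/-- The canonical measure `π_{L,N}`: a configuration `η` of `N` particles has probability
`∏_x w (η x) / Z_{L,N}`. -/
noncomputable def canonicalPMF (w : ℕ → ℝ) (hw : ∀ n, 0 < w n) (Λ : Type*) [Fintype Λ]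
    [Nonempty Λ] (N : ℕ) : PMF (Λ → ℕ) :=
  open Classical in
  PMF.ofFinset
    (fun η => if η ∈ configs Λ N then
      ENNReal.ofReal ((∏ x, w (η x)) / partitionFunction w Λ N) else 0)
    (configs Λ N)
    (by
      have hZ := partitionFunction_pos hw Λ N
      rw [Finset.sum_congr rfl fun η hη => if_pos hη, ← ENNReal.ofReal_sum_of_nonneg,
        ← Finset.sum_div]
      · change ENNReal.ofReal (partitionFunction w Λ N / partitionFunction w Λ N) = 1
        rw [div_self hZ.ne', ENNReal.ofReal_one]
      · intro η _
        exact div_nonneg (Finset.prod_nonneg fun x _ => (hw _).le) hZ.le)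
    (fun η hη => if_neg hη)

end Canonical

/-- `z(φ) = ∑_{n=0}^{A-1} φ^n w(n)`. -/
noncomputable def bulkZ (w : ℕ → ℝ) (A : ℕ) (φ : ℝ) : ℝ :=
  ∑ n ∈ Finset.range A, φ ^ n * w n

/-- `R(φ) = z(φ)⁻¹ ∑_{n=1}^{A-1} n φ^n w(n)`. -/
noncomputable def bulkDensity (w : ℕ → ℝ) (A : ℕ) (φ : ℝ) : ℝ :=
  (∑ n ∈ Finset.Icc 1 (A - 1), (n : ℝ) * φ ^ n * w n) / bulkZ w A φ

/-- The critical density `ρ_c = ∑_{n=1}^{A-1} n w(n) / ∑_{n=0}^{A-1} w(n)`. -/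
noncomputable def criticalDensity (w : ℕ → ℝ) (A : ℕ) : ℝ :=
  (∑ n ∈ Finset.Icc 1 (A - 1), (n : ℝ) * w n) / ∑ n ∈ Finset.range A, w n

theorem bulkZ_pos {w : ℕ → ℝ} {A : ℕ} (hA : 2 ≤ A) (hw : ∀ n, n < A → 0 < w n) {φ : ℝ}
    (hφ : 0 ≤ φ) : 0 < bulkZ w A φ := by
  refine Finset.sum_pos' (fun n hn => ?_) ⟨0, Finset.mem_range.2 (by omega), ?_⟩
  · exact mul_nonneg (pow_nonneg hφ n) (hw n (Finset.mem_range.1 hn)).le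
  · simpa using hw 0 (by omega)

/-- The single-site law `ν_φ` on `{0, …, A-1}`, with `ν_φ(k) = w(k) φ^k / z(φ)`. -/
noncomputable def bulkPMF (w : ℕ → ℝ) {A : ℕ} (hA : 2 ≤ A) (hw : ∀ n, n < A → 0 < w n)
    (φ : ℝ) (hφ : 0 ≤ φ) : PMF ℕ :=
  PMF.ofFinset
    (fun k => if k < A then ENNReal.ofReal (w k * φ ^ k / bulkZ w A φ) else 0)
    (Finset.range A)
    (by
      have hz := bulkZ_pos hA hw hφ
      rw [Finset.sum_congr rfl fun k hk => if_pos (Finset.mem_range.1 hk),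
        ← ENNReal.ofReal_sum_of_nonneg, ← Finset.sum_div]
      · have : ∑ k ∈ Finset.range A, w k * φ ^ k = bulkZ w A φ :=
          Finset.sum_congr rfl fun k _ => mul_comm _ _
        rw [this, div_self hz.ne', ENNReal.ofReal_one]
      · intro k hk
        exact div_nonneg (mul_nonneg (hw k (Finset.mem_range.1 hk)).le (pow_nonneg hφ k)) hz.le)
    (fun k hk => if_neg fun h => hk (Finset.mem_range.2 h))

/-- Along a sequence of lattices `Λ k`, particle numbers `N k` and weights `v k`, the occupation
numbers at the sites `x k 0, …, x k (m-1)` under the canonical measure converge in distribution to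
`m` iid random variables with law `ν`. -/
def SitesTendstoIID {Λ : ℕ → Type*} [∀ k, Fintype (Λ k)] [∀ k, Nonempty (Λ k)]
    (N : ℕ → ℕ) (v : ℕ → ℕ → ℝ) (hv : ∀ k n, 0 < v k n)
    {m : ℕ} (x : ∀ k, Fin m → Λ k) (ν : PMF ℕ) : Prop :=
  TendstoInDistribution
    (fun k (η : Λ k → ℕ) (i : Fin m) => η (x k i)) atTop
    (fun (ξ : Fin m → ℕ) (i : Fin m) => ξ i)
    (fun k => (canonicalPMF (v k) (hv k) (Λ k) (N k)).toMeasure)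
    (Measure.pi fun _ : Fin m => ν.toMeasure)

end ZRP

/-!
The canonical marginals are determined by ratios of partition functions: the probability that given
distinct sites hold `κ 1, …, κ m` particles is `∏ w(κ i) Z_{L-m,N-∑κ} / Z_{L,N}`. This
telescopes into one-site probabilities `r = w(k) Z_{L-1,N-k} / Z_{L,N}` (`siteProb`), so it suffices
that `r → ν_φ(k)` in every thermodynamic limit, with `φ ≤ 1` the solution of `R(φ) = ρ` below the
critical density and `φ = 1` above it (`tendsto_siteProb`, `tendsto_jointProb`).

By exchangeability, `L r` is the expected number of sites with `k` particles. Jensen's inequality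
gives `exp (h L r) ≤ Z^h_{L,N} / Z_{L,N}`, where `Z^h` is the partition function with the weight of
`k` multiplied by `exp h` (`exp_mul_siteProb_le`). At a subcritical fugacity `ψ < φ`:

* `Z^h_{L,N} ψ^N ≤ (z(ψ) + (exp h - 1) w(k) ψ^k + O(1/θ))^L`, a grand-canonical bound
  (`partitionFunction_mul_pow_le`, `sum_tilted_sizeWeight_le`);
* `Z_{L,N} ψ^N ≥ z(ψ)^L exp (-δ L)` for every `δ > (ρ - R(ψ)) |log ψ|`: by a weak law of large
  numbers, typical configurations on `L - 1` sites hold about `R(ψ) L` particles, and the remaining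
  site absorbs the excess at a cost of `1/θ = exp (-o(L))`
  (`eventually_le_partitionFunction_mul_pow`).

Hence asymptotically `h r ≤ (exp h - 1) ν_ψ(k) + (ρ - R(ψ)) |log ψ|`. As `ψ` increases to `φ` the
last term vanishes, because either `R(φ) = ρ` or `φ = 1`; letting `h` tend to `0` from both sides
yields `r → ν_φ(k)`. The only property of `θ` that matters is that it diverges subexponentially in
`L`.
-/

namespace ZRP

/-! ### Partition functions as coefficients of power series -/

/-- Sums of products over configurations of `N` particles are coefficients of a product of
generating functions, one for each site. -/
theorem sum_configs_prod {Λ : Type*} [Fintype Λ] (f : Λ → ℕ → ℝ) (N : ℕ) :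
    ∑ η ∈ configs Λ N, ∏ y, f y (η y) =
      PowerSeries.coeff N (∏ y, PowerSeries.mk (f y)) := by
  classical
  rw [PowerSeries.coeff_prod]
  refine Eq.symm (Finset.sum_bij (fun (l : Λ →₀ ℕ) _ => (l : Λ → ℕ)) ?_ ?_ ?_ ?_)
  · intro l hl
    exact mem_configs.2 (Finset.mem_finsuppAntidiag.1 hl).1
  · intro a _ b _ h
    exact DFunLike.coe_injective h
  · intro η hη
    refine ⟨Finsupp.equivFunOnFinite.symm η, ?_, rfl⟩
    simpa [Finset.mem_finsuppAntidiag] using mem_configs.1 hη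
  · intro l _
    simp

theorem partitionFunction_eq_coeff (v : ℕ → ℝ) (Λ : Type*) [Fintype Λ] (N : ℕ) :
    partitionFunction v Λ N =
      PowerSeries.coeff N (PowerSeries.mk v ^ Fintype.card Λ) := by
  unfold partitionFunction
  rw [sum_configs_prod (fun _ => v) N, Finset.prod_const, Finset.card_univ]

theorem partitionFunction_eq_fin (v : ℕ → ℝ) (Λ : Type*) [Fintype Λ] (N : ℕ) :
    partitionFunction v Λ N = partitionFunction v (Fin (Fintype.card Λ)) N := by
  simp [partitionFunction_eq_coeff]

open Classical in
/-- Fixing the occupation numbers at `m` distinct sites leaves a system with `m` sites fewer. -/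
theorem sum_configs_filter (v : ℕ → ℝ) {Λ : Type*} [Fintype Λ] (N : ℕ) {m : ℕ}
    {x : Fin m → Λ} (hx : Function.Injective x) (κ : Fin m → ℕ) (hκ : ∑ i, κ i ≤ N) :
    ∑ η ∈ (configs Λ N).filter (fun η => ∀ i, η (x i) = κ i), ∏ y, v (η y) =
      (∏ i, v (κ i)) * partitionFunction v (Fin (Fintype.card Λ - m)) (N - ∑ i, κ i) := by
  -- The constraint is a product of one-site factors, which turns the generating function of each
  -- constrained site into a monomial.
  let f : Λ → ℕ → ℝ := fun y n =>
    v n * ∏ i, if x i = y then (if n = κ i then 1 else 0) else 1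
  have hf : ∀ η : Λ → ℕ, ∏ y, f y (η y) =
      if ∀ i, η (x i) = κ i then ∏ y, v (η y) else 0 := by
    intro η
    simp only [f, Finset.prod_mul_distrib]
    rw [Finset.prod_comm]
    simp only [Finset.prod_ite_eq, Finset.mem_univ, if_true]
    rw [Finset.prod_ite_zero]
    simp
  rw [Finset.sum_filter]
  simp only [← hf]
  rw [sum_configs_prod]
  have h1 : ∀ i, PowerSeries.mk (f (x i)) = PowerSeries.monomial (κ i) (v (κ i)) := by
    intro i
    ext n
    rw [PowerSeries.coeff_mk, PowerSeries.coeff_monomial]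
    simp only [f, hx.eq_iff, Finset.prod_ite_eq', Finset.mem_univ, if_true]
    split_ifs with h
    · simp [h]
    · simp
  have h2 : ∀ y, y ∉ Finset.univ.image x → PowerSeries.mk (f y) = PowerSeries.mk v := by
    intro y hy
    ext n
    have : ∀ i, x i ≠ y := by simpa using hy
    simp [f, this]
  rw [← Finset.prod_mul_prod_compl (Finset.univ.image x), Finset.prod_image fun a _ b _ h => hx h,
    Finset.prod_congr rfl fun i _ => h1 i,
    Finset.prod_congr rfl fun y hy => h2 y (Finset.mem_compl.1 hy), Finset.prod_const,
    Finset.card_compl, Finset.card_image_of_injective _ hx, Finset.card_univ, Fintype.card_fin,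
    partitionFunction_eq_coeff, Fintype.card_fin]
  have h3 : ∏ i, PowerSeries.monomial (κ i) (v (κ i)) =
      PowerSeries.C (∏ i, v (κ i)) * PowerSeries.X ^ (∑ i, κ i) := by
    rw [PowerSeries.prod_monomial]
    ext n
    rw [PowerSeries.coeff_monomial, PowerSeries.coeff_C_mul, PowerSeries.coeff_X_pow]
    simp
  rw [h3, mul_assoc, PowerSeries.coeff_C_mul, PowerSeries.coeff_X_pow_mul', if_pos hκ]

/-- The grand-canonical upper bound on the partition function at fugacity `φ`. -/
theorem partitionFunction_mul_pow_le {v : ℕ → ℝ} (hv : ∀ n, 0 ≤ v n) {φ : ℝ} (hφ : 0 ≤ φ)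
    (L N : ℕ) :
    partitionFunction v (Fin L) N * φ ^ N ≤ (∑ n ∈ Finset.range (N + 1), v n * φ ^ n) ^ L := by
  have h := Finset.prod_univ_sum (fun _ : Fin L => Finset.range (N + 1))
    (fun _ n => v n * φ ^ n)
  rw [Finset.prod_const, Finset.card_univ, Fintype.card_fin] at h
  rw [h, partitionFunction, Finset.sum_mul]
  calc ∑ η ∈ configs (Fin L) N, (∏ x, v (η x)) * φ ^ N
      = ∑ η ∈ configs (Fin L) N, ∏ x, v (η x) * φ ^ η x := by
        refine Finset.sum_congr rfl fun η hη => ?_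
        rw [Finset.prod_mul_distrib, Finset.prod_pow_eq_pow_sum, mem_configs.1 hη]
    _ ≤ _ := by
        refine Finset.sum_le_sum_of_subset_of_nonneg (fun η hη => ?_) fun η _ _ =>
          Finset.prod_nonneg fun x _ => mul_nonneg (hv _) (pow_nonneg hφ _)
        rw [Fintype.mem_piFinset]
        intro i
        rw [Finset.mem_range, Nat.lt_succ_iff, ← mem_configs.1 hη]
        exact Finset.single_le_sum (fun j _ => Nat.zero_le (η j)) (Finset.mem_univ i)

/-- One additional site can take up the particles missing from configurations of at most `N`
particles. -/
theorem sum_le_partitionFunction_succ {v : ℕ → ℝ} (hv : ∀ n, 0 ≤ v n) {L N : ℕ}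
    (E : Finset (Fin L → ℕ)) (hE : ∀ η ∈ E, ∑ x, η x ≤ N) :
    ∑ η ∈ E, v (N - ∑ x, η x) * ∏ x, v (η x) ≤ partitionFunction v (Fin (L + 1)) N := by
  classical
  let g : (Fin L → ℕ) → (Fin (L + 1) → ℕ) := fun η => Fin.cons (N - ∑ x, η x) η
  have hg : Set.InjOn g E := fun a _ b _ h => (Fin.cons_injective2 h).2
  have h1 : ∑ η ∈ E, v (N - ∑ x, η x) * ∏ x, v (η x) = ∑ η ∈ E.image g, ∏ x, v (η x) := by
    rw [Finset.sum_image hg]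
    refine Finset.sum_congr rfl fun η _ => ?_
    simp [g, Fin.prod_univ_succ]
  rw [h1]
  refine Finset.sum_le_sum_of_subset_of_nonneg ?_ fun η _ _ => Finset.prod_nonneg fun x _ => hv _
  intro ξ hξ
  obtain ⟨η, hη, rfl⟩ := Finset.mem_image.1 hξ
  rw [mem_configs, Fin.sum_univ_succ]
  have := hE η hη
  simp only [g, Fin.cons_zero, Fin.cons_succ]
  omega

/-! ### The probability of an occupation number at one site -/

/-- The probability `w(k) Z_{L-1,N-k} / Z_{L,N}` that a given site holds `k` particles. -/
noncomputable def siteProb (v : ℕ → ℝ) (L N k : ℕ) : ℝ :=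
  v k * partitionFunction v (Fin (L - 1)) (N - k) / partitionFunction v (Fin L) N

/-- Jensen's inequality bounds the one-site probability by the free energy of the system in which
the weight of `k` particles is multiplied by `exp h`. -/
theorem exp_mul_siteProb_le {v : ℕ → ℝ} (hv : ∀ n, 0 < v n) {L N k : ℕ} (hL : 0 < L)
    (hk : k ≤ N) (h : ℝ) :
    Real.exp (h * (L * siteProb v L N k)) * partitionFunction v (Fin L) N ≤
      partitionFunction (fun n => v n * Real.exp (if n = k then h else 0)) (Fin L) N := by
  classical
  have : Nonempty (Fin L) := ⟨⟨0, hL⟩⟩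
  have hZ := partitionFunction_pos hv (Fin L) N
  set Z := partitionFunction v (Fin L) N with hZdef
  have hcount : ∑ η ∈ configs (Fin L) N, (∏ x, v (η x)) / Z *
      ∑ x, (if η x = k then h else 0) = h * (L * siteProb v L N k) := by
    simp only [Finset.mul_sum]
    rw [Finset.sum_comm]
    have : ∀ y : Fin L, ∑ η ∈ configs (Fin L) N, (∏ x, v (η x)) / Z *
        (if η y = k then h else 0) = h * siteProb v L N k := by
      intro y
      have h1 := sum_configs_filter v N (x := fun _ : Fin 1 => y)
        (Function.injective_of_subsingleton _) (fun _ => k) (by simpa using hk)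
      simp only [Fin.forall_fin_one, Finset.univ_unique, Finset.prod_const, Finset.sum_const,
        Finset.card_singleton, pow_one, one_smul] at h1
      rw [Fintype.card_fin] at h1
      rw [siteProb, ← h1, Finset.sum_filter, Finset.sum_div, Finset.mul_sum]
      refine Finset.sum_congr rfl fun η _ => ?_
      split_ifs <;> simp [hZdef]; ring
    rw [Finset.sum_congr rfl fun y _ => this y]
    simp; ring
  have hJ := convexOn_exp.map_sum_le (t := configs (Fin L) N)
    (w := fun η => (∏ x, v (η x)) / Z) (p := fun η => ∑ x, (if η x = k then h else 0))
    (fun η _ => div_nonneg (Finset.prod_nonneg fun x _ => (hv _).le) hZ.le)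
    (by rw [← Finset.sum_div]; exact div_self hZ.ne') (fun _ _ => Set.mem_univ _)
  simp only [smul_eq_mul] at hJ
  rw [hcount] at hJ
  refine (mul_le_mul_of_nonneg_right hJ hZ.le).trans_eq ?_
  rw [Finset.sum_mul, partitionFunction]
  refine Finset.sum_congr rfl fun η _ => ?_
  rw [Finset.prod_mul_distrib, Real.exp_sum]
  field_simp

/-! ### The bulk law and the bulk density -/

/-- The probabilities `w(k) φ^k / z(φ)` of the law `ν_φ`, as real numbers. -/
noncomputable def bulkMass (w : ℕ → ℝ) (A : ℕ) (φ : ℝ) (k : ℕ) : ℝ :=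
  w k * φ ^ k / bulkZ w A φ

theorem sum_bulkMass {w : ℕ → ℝ} {A : ℕ} (hA : 2 ≤ A) (hw : ∀ n, n < A → 0 < w n) {φ : ℝ}
    (hφ : 0 ≤ φ) : ∑ k ∈ Finset.range A, bulkMass w A φ k = 1 := by
  have hz := bulkZ_pos hA hw hφ
  unfold bulkMass
  rw [← Finset.sum_div, div_eq_one_iff_eq hz.ne']
  exact Finset.sum_congr rfl fun k _ => mul_comm _ _

theorem bulkMass_nonneg {w : ℕ → ℝ} {A : ℕ} (hA : 2 ≤ A) (hw : ∀ n, n < A → 0 < w n) {φ : ℝ}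
    (hφ : 0 ≤ φ) {k : ℕ} (hk : k < A) : 0 ≤ bulkMass w A φ k :=
  div_nonneg (mul_nonneg (hw k hk).le (pow_nonneg hφ k)) (bulkZ_pos hA hw hφ).le

theorem sum_Icc_eq_sum_range {A : ℕ} (hA : 2 ≤ A) (f : ℕ → ℝ) :
    ∑ n ∈ Finset.Icc 1 (A - 1), (n : ℝ) * f n = ∑ n ∈ Finset.range A, (n : ℝ) * f n := by
  refine Finset.sum_subset (fun n hn => ?_) fun n hn hn' => ?_
  · have := Finset.mem_Icc.1 hn
    exact Finset.mem_range.2 (by omega)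
  · have h1 := Finset.mem_range.1 hn
    have : n = 0 := by
      by_contra h0
      exact hn' (Finset.mem_Icc.2 ⟨by omega, by omega⟩)
    simp [this]

theorem bulkDensity_eq_sum_range {w : ℕ → ℝ} {A : ℕ} (hA : 2 ≤ A) (φ : ℝ) :
    bulkDensity w A φ = (∑ n ∈ Finset.range A, (n : ℝ) * (φ ^ n * w n)) / bulkZ w A φ := by
  unfold bulkDensity
  rw [← sum_Icc_eq_sum_range hA]
  simp only [mul_assoc]

/-- The bulk density is the mean of the bulk law. -/
theorem bulkDensity_eq_mean {w : ℕ → ℝ} {A : ℕ} (hA : 2 ≤ A) (φ : ℝ) :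
    bulkDensity w A φ = ∑ n ∈ Finset.range A, (n : ℝ) * bulkMass w A φ n := by
  rw [bulkDensity_eq_sum_range hA, Finset.sum_div]
  refine Finset.sum_congr rfl fun n _ => ?_
  rw [bulkMass]
  ring

theorem bulkDensity_one {w : ℕ → ℝ} {A : ℕ} : bulkDensity w A 1 = criticalDensity w A := by
  simp [bulkDensity, bulkZ, criticalDensity]

theorem bulkDensity_zero {w : ℕ → ℝ} {A : ℕ} (hA : 2 ≤ A) : bulkDensity w A 0 = 0 := by
  rw [bulkDensity_eq_sum_range hA, Finset.sum_eq_zero, zero_div]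
  intro n _
  rcases Nat.eq_zero_or_pos n with h | h
  · simp [h]
  · simp [zero_pow h.ne']

theorem continuous_bulkZ (w : ℕ → ℝ) (A : ℕ) : Continuous (bulkZ w A) := by
  unfold bulkZ
  fun_prop

theorem continuousAt_bulkMass {w : ℕ → ℝ} {A : ℕ} (hA : 2 ≤ A) (hw : ∀ n, n < A → 0 < w n)
    {φ : ℝ} (hφ : 0 ≤ φ) (k : ℕ) : ContinuousAt (fun ψ => bulkMass w A ψ k) φ := by
  unfold bulkMass
  have := (continuous_bulkZ w A).continuousAt (x := φ)
  exact ContinuousAt.div (by fun_prop) this (bulkZ_pos hA hw hφ).ne'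

theorem continuousAt_bulkDensity {w : ℕ → ℝ} {A : ℕ} (hA : 2 ≤ A) (hw : ∀ n, n < A → 0 < w n)
    {φ : ℝ} (hφ : 0 ≤ φ) : ContinuousAt (bulkDensity w A) φ := by
  unfold bulkDensity
  have := (continuous_bulkZ w A).continuousAt (x := φ)
  exact ContinuousAt.div (by fun_prop) this (bulkZ_pos hA hw hφ).ne'

/-- The bulk density is strictly increasing. After cross-multiplication and symmetrization, the
difference of two values is a sum of nonnegative terms `(i - j) (ψ^i φ^j - φ^i ψ^j) w(i) w(j)`. -/
theorem strictMonoOn_bulkDensity {w : ℕ → ℝ} {A : ℕ} (hA : 2 ≤ A)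
    (hw : ∀ n, n < A → 0 < w n) : StrictMonoOn (bulkDensity w A) (Set.Ici 0) := by
  intro φ hφ ψ hψ hlt
  have hφ : 0 ≤ φ := hφ
  have hψ : 0 ≤ ψ := hψ
  rw [bulkDensity_eq_sum_range hA, bulkDensity_eq_sum_range hA,
    div_lt_div_iff₀ (bulkZ_pos hA hw hφ) (bulkZ_pos hA hw hψ), ← sub_pos]
  let F : ℕ → ℕ → ℝ := fun i j => w i * w j * (ψ ^ i * φ ^ j - φ ^ i * ψ ^ j)
  have hD : (∑ n ∈ Finset.range A, (n : ℝ) * (ψ ^ n * w n)) * bulkZ w A φ -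
      (∑ n ∈ Finset.range A, (n : ℝ) * (φ ^ n * w n)) * bulkZ w A ψ =
      ∑ i ∈ Finset.range A, ∑ j ∈ Finset.range A, (i : ℝ) * F i j := by
    unfold bulkZ
    rw [Finset.sum_mul_sum, Finset.sum_mul_sum, ← Finset.sum_sub_distrib]
    refine Finset.sum_congr rfl fun i _ => ?_
    rw [← Finset.sum_sub_distrib]
    refine Finset.sum_congr rfl fun j _ => ?_
    simp only [F]
    ring
  have hD' : ∑ i ∈ Finset.range A, ∑ j ∈ Finset.range A, (i : ℝ) * F i j =
      ∑ i ∈ Finset.range A, ∑ j ∈ Finset.range A, -((j : ℝ) * F i j) := by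
    rw [Finset.sum_comm]
    refine Finset.sum_congr rfl fun i _ => Finset.sum_congr rfl fun j _ => ?_
    simp only [F]
    ring
  have h2 : 2 * ∑ i ∈ Finset.range A, ∑ j ∈ Finset.range A, (i : ℝ) * F i j =
      ∑ i ∈ Finset.range A, ∑ j ∈ Finset.range A, ((i : ℝ) - j) * F i j := by
    rw [two_mul]
    nth_rw 2 [hD']
    rw [← Finset.sum_add_distrib]
    refine Finset.sum_congr rfl fun i _ => ?_
    rw [← Finset.sum_add_distrib]
    refine Finset.sum_congr rfl fun j _ => ?_
    ring
  have key : ∀ i j : ℕ, j ≤ i → 0 ≤ ψ ^ i * φ ^ j - φ ^ i * ψ ^ j := by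
    intro i j hij
    obtain ⟨d, rfl⟩ := Nat.exists_eq_add_of_le hij
    have h1 : φ ^ d ≤ ψ ^ d := pow_le_pow_left₀ hφ hlt.le d
    have h2 : 0 ≤ (ψ ^ j * φ ^ j) * (ψ ^ d - φ ^ d) := by
      have := pow_nonneg hφ j
      have := pow_nonneg hψ j
      have := sub_nonneg.2 h1
      positivity
    rw [pow_add, pow_add]
    linarith
  have hterm : ∀ i ∈ Finset.range A, ∀ j ∈ Finset.range A, 0 ≤ ((i : ℝ) - j) * F i j := by
    intro i hi j hj
    have hwi := hw i (Finset.mem_range.1 hi)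
    have hwj := hw j (Finset.mem_range.1 hj)
    rcases le_total j i with h | h
    · exact mul_nonneg (sub_nonneg.2 (by exact_mod_cast h))
        (mul_nonneg (by positivity) (key i j h))
    · refine mul_nonneg_of_nonpos_of_nonpos (sub_nonpos.2 (by exact_mod_cast h))
        (mul_nonpos_of_nonneg_of_nonpos (by positivity) ?_)
      have := key j i h
      linarith
  have hpos : 0 < ∑ i ∈ Finset.range A, ∑ j ∈ Finset.range A, ((i : ℝ) - j) * F i j := by
    refine Finset.sum_pos' (fun i hi => Finset.sum_nonneg fun j hj => hterm i hi j hj)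
      ⟨1, Finset.mem_range.2 (by omega), ?_⟩
    refine Finset.sum_pos' (fun j hj => hterm 1 (Finset.mem_range.2 (by omega)) j hj)
      ⟨0, Finset.mem_range.2 (by omega), ?_⟩
    have h0 := hw 0 (by omega)
    have h1 := hw 1 (by omega)
    have := sub_pos.2 hlt
    simp only [F]
    norm_num
    positivity
  rw [hD]
  linarith

/-! ### Concentration of the particle number -/

/-- Chernoff bound: if `f` has negative mean under the finitely supported law `p`, then a sum of `L`
independent copies of `f` is nonnegative with vanishing probability. -/
theorem tendsto_prob_sum_nonneg {p : ℕ → ℝ} {A : ℕ} (hp : ∀ n, n < A → 0 ≤ p n)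
    (hp1 : ∑ n ∈ Finset.range A, p n = 1) {f : ℕ → ℝ}
    (hf : ∑ n ∈ Finset.range A, p n * f n < 0) :
    Tendsto (fun L : ℕ =>
      ∑ η ∈ (Fintype.piFinset fun _ : Fin L => Finset.range A).filter
        (fun η => 0 ≤ ∑ x, f (η x)), ∏ x, p (η x)) atTop (𝓝 0) := by
  obtain ⟨t, ht0, ht⟩ : ∃ t : ℝ, 0 < t ∧
      ∑ n ∈ Finset.range A, p n * Real.exp (t * f n) < 1 := by
    have hd : HasDerivAt (fun t : ℝ => ∑ n ∈ Finset.range A, p n * Real.exp (t * f n))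
        (∑ n ∈ Finset.range A, p n * f n) 0 := by
      refine HasDerivAt.fun_sum fun n _ => ?_
      have := (((hasDerivAt_id (0 : ℝ)).mul_const (f n)).exp).const_mul (p n)
      simpa using this
    have h1 := hd.tendsto_slope_zero_right
    have h2 := (h1.eventually (gt_mem_nhds hf)).and (self_mem_nhdsWithin)
    obtain ⟨t, ht, ht0⟩ := h2.exists
    have ht0 : 0 < t := ht0
    refine ⟨t, ht0, ?_⟩
    simp only [zero_add, zero_mul, Real.exp_zero, mul_one, hp1, smul_eq_mul] at ht
    have := (pos_iff_neg_of_mul_neg ht).1 (inv_pos.2 ht0)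
    linarith
  set q := ∑ n ∈ Finset.range A, p n * Real.exp (t * f n) with hq
  have hq0 : 0 ≤ q := Finset.sum_nonneg fun n hn =>
    mul_nonneg (hp n (Finset.mem_range.1 hn)) (Real.exp_pos _).le
  have hpη : ∀ L : ℕ, ∀ η ∈ Fintype.piFinset fun _ : Fin L => Finset.range A,
      0 ≤ ∏ x, p (η x) := fun L η hη => Finset.prod_nonneg fun x _ =>
        hp _ (Finset.mem_range.1 (Fintype.mem_piFinset.1 hη x))
  refine squeeze_zero (fun L => Finset.sum_nonneg fun η hη =>
    hpη L η (Finset.mem_filter.1 hη).1) (fun L => ?_)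
    (tendsto_pow_atTop_nhds_zero_of_lt_one hq0 ht)
  have h := Finset.prod_univ_sum (fun _ : Fin L => Finset.range A)
    (fun _ n => p n * Real.exp (t * f n))
  rw [Finset.prod_const, Finset.card_univ, Fintype.card_fin] at h
  rw [hq, h]
  simp only [Finset.prod_mul_distrib, ← Real.exp_sum, ← Finset.mul_sum]
  refine (Finset.sum_le_sum fun η hη => ?_).trans (Finset.sum_le_sum_of_subset_of_nonneg
    (Finset.filter_subset _ _) fun η hη _ => mul_nonneg (hpη L η hη) (Real.exp_pos _).le)
  have hη' := Finset.mem_filter.1 hη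
  exact le_mul_of_one_le_right (hpη L η hη'.1)
    (Real.one_le_exp (mul_nonneg ht0.le hη'.2))

/-- The configurations of `L` sites with occupation numbers below `A` and particle number strictly
between `a L` and `b L`. -/
noncomputable def windowConfigs (A : ℕ) (a b : ℝ) (L : ℕ) : Finset (Fin L → ℕ) :=
  (Fintype.piFinset fun _ : Fin L => Finset.range A).filter
    fun η => a * L < ∑ x, (η x : ℝ) ∧ ∑ x, (η x : ℝ) < b * L

/-- Weak law of large numbers for the particle number under the product of bulk laws. -/
theorem eventually_half_le_window {w : ℕ → ℝ} {A : ℕ} (hA : 2 ≤ A)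
    (hw : ∀ n, n < A → 0 < w n) {φ : ℝ} (hφ : 0 ≤ φ) {a b : ℝ} (ha : a < bulkDensity w A φ)
    (hb : bulkDensity w A φ < b) :
    ∀ᶠ L : ℕ in atTop, 1 / 2 ≤ ∑ η ∈ windowConfigs A a b L, ∏ x, bulkMass w A φ (η x) := by
  set p := bulkMass w A φ with hp
  have hp0 : ∀ n, n < A → 0 ≤ p n := fun n hn => bulkMass_nonneg hA hw hφ hn
  have hp1 : ∑ n ∈ Finset.range A, p n = 1 := sum_bulkMass hA hw hφ
  rw [bulkDensity_eq_mean hA] at ha hb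
  have h1 := tendsto_prob_sum_nonneg hp0 hp1 (f := fun n => a - n) (by
    simp only [mul_sub, Finset.sum_sub_distrib, ← Finset.sum_mul, hp1]
    simp only [mul_comm (p _)]
    linarith)
  have h2 := tendsto_prob_sum_nonneg hp0 hp1 (f := fun n => n - b) (by
    simp only [mul_sub, Finset.sum_sub_distrib, ← Finset.sum_mul, hp1]
    simp only [mul_comm (p _)]
    linarith)
  filter_upwards [h1.eventually (gt_mem_nhds (show (0 : ℝ) < 1 / 4 by norm_num)),
    h2.eventually (gt_mem_nhds (show (0 : ℝ) < 1 / 4 by norm_num))] with L hL1 hL2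
  have h := Finset.prod_univ_sum (fun _ : Fin L => Finset.range A) (fun _ n => p n)
  rw [Finset.prod_const, hp1, one_pow] at h
  have hpη : ∀ η ∈ Fintype.piFinset fun _ : Fin L => Finset.range A,
      0 ≤ ∏ x, p (η x) := fun η hη => Finset.prod_nonneg fun x _ =>
        hp0 _ (Finset.mem_range.1 (Fintype.mem_piFinset.1 hη x))
  have hle : (1 : ℝ) ≤ ∑ η ∈ windowConfigs A a b L, ∏ x, p (η x) +
      (∑ η ∈ (Fintype.piFinset fun _ : Fin L => Finset.range A).filter
        (fun η => 0 ≤ ∑ x, (a - η x)), ∏ x, p (η x) +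
      ∑ η ∈ (Fintype.piFinset fun _ : Fin L => Finset.range A).filter
        (fun η => 0 ≤ ∑ x, ((η x : ℝ) - b)), ∏ x, p (η x)) := by
    rw [h, windowConfigs, Finset.sum_filter, Finset.sum_filter, Finset.sum_filter,
      ← Finset.sum_add_distrib, ← Finset.sum_add_distrib]
    refine Finset.sum_le_sum fun η hη => ?_
    have h0 := hpη η hη
    have e1 : ∑ x, (a - (η x : ℝ)) = a * L - ∑ x, (η x : ℝ) := by
      simp [Finset.sum_sub_distrib, mul_comm]
    have e2 : ∑ x, ((η x : ℝ) - b) = ∑ x, (η x : ℝ) - b * L := by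
      simp [Finset.sum_sub_distrib, mul_comm]
    rw [e1, e2]
    split_ifs with i1 i2 i3 i3 i2 i3 i3 <;> try linarith
    exact absurd ⟨by linarith, by linarith⟩ i1
  linarith

/-! ### Free energy bounds in the thermodynamic limit -/

/-- The thermodynamic limit with density `ρ`, for a parameter `θ` that diverges subexponentially in
the number of sites. Decoupling `θ` from a power of `L` makes the class of sequences stable
under the removal of a site. -/
structure ThermodynamicLimit (L N : ℕ → ℕ) (θ : ℕ → ℝ) (ρ : ℝ) : Prop where
  sites : Tendsto L atTop atTop
  density : Tendsto (fun k => (N k : ℝ) / L k) atTop (𝓝 ρ)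
  rate : Tendsto θ atTop atTop
  log_rate : Tendsto (fun k => Real.log (θ k) / L k) atTop (𝓝 0)

theorem ThermodynamicLimit.tendsto_particles {L N : ℕ → ℕ} {θ : ℕ → ℝ} {ρ : ℝ}
    (h : ThermodynamicLimit L N θ ρ) (hρ : 0 < ρ) : Tendsto N atTop atTop := by
  have h1 : Tendsto (fun k => (N k : ℝ) / L k * L k) atTop atTop :=
    h.density.pos_mul_atTop hρ (tendsto_natCast_atTop_atTop.comp h.sites)
  refine tendsto_natCast_atTop_iff.1 (h1.congr' ?_)
  filter_upwards [h.sites.eventually_gt_atTop 0] with k hk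
  have : (L k : ℝ) ≠ 0 := by exact_mod_cast hk.ne'
  field_simp

/-- Removing a site with its particles does not affect the thermodynamic limit. -/
theorem ThermodynamicLimit.remove_site {L N : ℕ → ℕ} {θ : ℕ → ℝ} {ρ : ℝ}
    (h : ThermodynamicLimit L N θ ρ) (hρ : 0 < ρ) (κ : ℕ) :
    ThermodynamicLimit (fun k => L k - 1) (fun k => N k - κ) θ ρ := by
  have hcast : Tendsto (fun k => (L k : ℝ)) atTop atTop :=
    tendsto_natCast_atTop_atTop.comp h.sites
  have hratio : Tendsto (fun k => (L k : ℝ) / ((L k - 1 : ℕ) : ℝ)) atTop (𝓝 1) := by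
    have h1 : Tendsto (fun k => (1 - 1 / (L k : ℝ))⁻¹) atTop (𝓝 ((1 - 0)⁻¹)) :=
      (tendsto_const_nhds.sub (tendsto_const_nhds.div_atTop hcast)).inv₀ (by norm_num)
    rw [sub_zero, inv_one] at h1
    refine h1.congr' ?_
    filter_upwards [h.sites.eventually_gt_atTop 1] with k hk
    have h2 : (1 : ℝ) < L k := by exact_mod_cast hk
    have h3 : (L k : ℝ) - 1 ≠ 0 := by linarith
    rw [Nat.cast_sub hk.le, Nat.cast_one]
    field_simp
  refine ⟨(tendsto_sub_atTop_nat 1).comp h.sites, ?_, h.rate, ?_⟩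
  · have h1 : Tendsto (fun k => ((N k : ℝ) / L k - κ / L k) * (L k / ((L k - 1 : ℕ) : ℝ))) atTop
        (𝓝 ((ρ - 0) * 1)) :=
      (h.density.sub (tendsto_const_nhds.div_atTop hcast)).mul hratio
    rw [sub_zero, mul_one] at h1
    refine h1.congr' ?_
    filter_upwards [h.sites.eventually_gt_atTop 1,
      (h.tendsto_particles hρ).eventually_ge_atTop κ] with k hk hκ
    have h2 : (1 : ℝ) < L k := by exact_mod_cast hk
    have h3 : (L k : ℝ) - 1 ≠ 0 := by linarith
    rw [Nat.cast_sub hk.le, Nat.cast_one, Nat.cast_sub hκ]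
    field_simp
  · have h1 := h.log_rate.mul hratio
    rw [zero_mul] at h1
    refine h1.congr' ?_
    filter_upwards [h.sites.eventually_gt_atTop 1] with k hk
    have h2 : (1 : ℝ) < L k := by exact_mod_cast hk
    have h3 : (L k : ℝ) - 1 ≠ 0 := by linarith
    rw [Nat.cast_sub hk.le, Nat.cast_one]
    field_simp

/-- Lower bound on the free energy. At a subcritical fugacity `φ`, typical configurations of `L - 1`
sites hold about `R(φ) L ≤ N` particles; the last site takes the excess `N - R(φ) L` at the
subexponential cost `1 / θ`. -/
theorem eventually_le_partitionFunction_mul_pow {w : ℕ → ℝ} {A : ℕ} (hA : 2 ≤ A)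
    (hw : ∀ n, n < A → 0 < w n) {φ : ℝ} (hφ : 0 < φ) (hφ1 : φ < 1)
    {L N : ℕ → ℕ} {θ : ℕ → ℝ} {ρ : ℝ} (hT : ThermodynamicLimit L N θ ρ)
    (hR : bulkDensity w A φ < ρ) {δ : ℝ}
    (hδ : (ρ - bulkDensity w A φ) * (-Real.log φ) < δ) :
    ∀ᶠ k in atTop, bulkZ w A φ ^ L k * Real.exp (-(δ * L k)) ≤
      partitionFunction (sizeWeight w A (θ k)) (Fin (L k)) (N k) * φ ^ N k := by
  have hz := bulkZ_pos hA hw hφ.le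
  set z := bulkZ w A φ with hzdef
  have hlog : 0 < -Real.log φ := neg_pos.2 (Real.log_neg hφ hφ1)
  obtain ⟨b, hRb, hbρ⟩ := exists_between hR
  obtain ⟨a, haR, haδ⟩ : ∃ a < bulkDensity w A φ, (ρ - a) * (-Real.log φ) < δ := by
    have hc : ContinuousAt (fun a : ℝ => (ρ - a) * (-Real.log φ)) (bulkDensity w A φ) := by
      fun_prop
    have h1 := (hc.eventually (gt_mem_nhds hδ)).filter_mono
      (nhdsWithin_le_nhds (s := Set.Iio (bulkDensity w A φ)))
    obtain ⟨a, ha1, ha2⟩ := (h1.and self_mem_nhdsWithin).exists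
    exact ⟨a, ha2, ha1⟩
  obtain ⟨c, hc0, hc1, hcw⟩ : ∃ c : ℝ, 0 < c ∧ c ≤ 1 ∧ ∀ n < A, c ≤ w n := by
    obtain ⟨i, hi, hmin⟩ := Finset.exists_min_image (Finset.range A) w
      ⟨0, Finset.mem_range.2 (by omega)⟩
    exact ⟨min 1 (w i), lt_min one_pos (hw i (Finset.mem_range.1 hi)), min_le_left _ _,
      fun n hn => (min_le_right _ _).trans (hmin n (Finset.mem_range.2 hn))⟩
  have hcast : Tendsto (fun k => (L k : ℝ)) atTop atTop :=
    tendsto_natCast_atTop_atTop.comp hT.sites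
  -- The logarithm of the quotient of the two sides, divided by `L`, has a positive limit.
  have hlim : Tendsto (fun k => (Real.log (c / 2) - Real.log z + Real.log φ * a) / L k -
      Real.log (θ k) / L k + Real.log φ * ((N k : ℝ) / L k - a) + δ) atTop
      (𝓝 (0 - 0 + Real.log φ * (ρ - a) + δ)) :=
    (((tendsto_const_nhds.div_atTop hcast).sub hT.log_rate).add
      ((hT.density.sub_const a).const_mul _)).add_const δ
  have hev := hlim.eventually (lt_mem_nhds (show 0 < 0 - 0 + Real.log φ * (ρ - a) + δ by linarith))
  have hwin := ((tendsto_sub_atTop_nat 1).comp hT.sites).eventually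
    (eventually_half_le_window hA hw hφ.le haR hRb)
  filter_upwards [hev, hwin, hT.rate.eventually_ge_atTop 1, hT.sites.eventually_gt_atTop 0,
    hT.density.eventually (lt_mem_nhds hbρ)] with k hk hkwin hθ1 hL hN
  obtain ⟨M, hM⟩ : ∃ M, L k = M + 1 := ⟨L k - 1, by omega⟩
  have hθ0 : 0 < θ k := by linarith
  rw [Function.comp_apply, show L k - 1 = M by omega] at hkwin
  rw [hM] at hk hN ⊢
  have hM0 : (0 : ℝ) < ((M + 1 : ℕ) : ℝ) := by positivity
  have hR0 : 0 ≤ bulkDensity w A φ := by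
    rw [bulkDensity_eq_mean hA]
    exact Finset.sum_nonneg fun n hn => mul_nonneg (Nat.cast_nonneg n)
      (bulkMass_nonneg hA hw hφ.le (Finset.mem_range.1 hn))
  have hbN : b * M ≤ N k := by
    have h1 := (lt_div_iff₀ hM0).1 hN
    push_cast at h1
    nlinarith
  set v := sizeWeight w A (θ k) with hv
  have hvpos : ∀ n, 0 < v n := sizeWeight_pos hw hθ0
  have hvc : ∀ n, c / θ k ≤ v n := by
    intro n
    simp only [hv, sizeWeight]
    split_ifs with h
    · exact (div_le_self hc0.le hθ1).trans (hcw n h)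
    · gcongr
  have hE : ∀ η ∈ windowConfigs A a b M, ∑ x, η x ≤ N k := by
    intro η hη
    have h1 := (Finset.mem_filter.1 hη).2.2
    have : (∑ x, (η x : ℝ)) ≤ N k := h1.le.trans hbN
    exact_mod_cast this
  have hmain : c / θ k * Real.exp (Real.log φ * (N k - a * M)) * z ^ M * (1 / 2) ≤
      partitionFunction v (Fin (M + 1)) (N k) * φ ^ N k := by
    calc c / θ k * Real.exp (Real.log φ * (N k - a * M)) * z ^ M * (1 / 2)
        ≤ c / θ k * Real.exp (Real.log φ * (N k - a * M)) * z ^ M *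
            ∑ η ∈ windowConfigs A a b M, ∏ x, bulkMass w A φ (η x) := by gcongr
      _ ≤ (∑ η ∈ windowConfigs A a b M, v (N k - ∑ x, η x) * ∏ x, v (η x)) * φ ^ N k := by
          rw [Finset.mul_sum, Finset.sum_mul]
          refine Finset.sum_le_sum fun η hη => ?_
          have hη' := Finset.mem_filter.1 hη
          have hS := hE η hη
          have h1 : z ^ M * ∏ x, bulkMass w A φ (η x) = (∏ x, v (η x)) * φ ^ (∑ x, η x) := by
            have : ∀ x, bulkMass w A φ (η x) = v (η x) * φ ^ η x * z⁻¹ := by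
              intro x
              have := Finset.mem_range.1 (Fintype.mem_piFinset.1 hη'.1 x)
              simp [bulkMass, hv, sizeWeight, this, ← hzdef, div_eq_mul_inv]
            simp only [this, Finset.prod_mul_distrib, Finset.prod_pow_eq_pow_sum]
            simp only [Finset.prod_const, Finset.card_univ, Fintype.card_fin, inv_pow]
            field_simp
          have h2 : Real.exp (Real.log φ * (N k - a * M)) ≤ φ ^ (N k - ∑ x, η x) := by
            rw [← Real.rpow_natCast, Real.rpow_def_of_pos hφ, Real.exp_le_exp,
              Nat.cast_sub hS, Nat.cast_sum]
            refine mul_le_mul_of_nonpos_left ?_ (by linarith)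
            linarith [hη'.2.1]
          have h3 : φ ^ N k = φ ^ (N k - ∑ x, η x) * φ ^ (∑ x, η x) := by
            rw [← pow_add, Nat.sub_add_cancel hS]
          have h4 : 0 ≤ ∏ x, v (η x) := Finset.prod_nonneg fun x _ => (hvpos _).le
          calc c / θ k * Real.exp (Real.log φ * (N k - a * M)) * z ^ M *
                ∏ x, bulkMass w A φ (η x)
              = c / θ k * Real.exp (Real.log φ * (N k - a * M)) *
                  ((∏ x, v (η x)) * φ ^ (∑ x, η x)) := by rw [← h1]; ring
            _ ≤ v (N k - ∑ x, η x) * φ ^ (N k - ∑ x, η x) *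
                  ((∏ x, v (η x)) * φ ^ (∑ x, η x)) := by
                have := hvc (N k - ∑ x, η x)
                have := (hvpos (N k - ∑ x, η x)).le
                gcongr
            _ = _ := by rw [h3]; ring
      _ ≤ _ := mul_le_mul_of_nonneg_right
          (sum_le_partitionFunction_succ (fun n => (hvpos n).le) _ hE) (by positivity)
  refine le_trans ?_ hmain
  have hexp : Real.exp (-(δ * ((M + 1 : ℕ) : ℝ))) * z ≤
      c / θ k * Real.exp (Real.log φ * (N k - a * M)) * (1 / 2) := by
    have e1 : c / θ k * Real.exp (Real.log φ * (N k - a * M)) * (1 / 2) =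
        Real.exp (Real.log (c / 2) - Real.log (θ k) + Real.log φ * (N k - a * M)) := by
      rw [Real.exp_add, Real.exp_sub, Real.exp_log (by positivity), Real.exp_log hθ0]
      ring
    have e2 : Real.exp (-(δ * ((M + 1 : ℕ) : ℝ))) * z =
        Real.exp (-(δ * ((M + 1 : ℕ) : ℝ)) + Real.log z) := by
      rw [Real.exp_add, Real.exp_log hz]
    rw [e1, e2, Real.exp_le_exp]
    have h1 := mul_pos hk hM0
    have e3 : ((Real.log (c / 2) - Real.log z + Real.log φ * a) / ((M + 1 : ℕ) : ℝ) -
        Real.log (θ k) / ((M + 1 : ℕ) : ℝ) +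
        Real.log φ * ((N k : ℝ) / ((M + 1 : ℕ) : ℝ) - a) + δ) * ((M + 1 : ℕ) : ℝ) =
        (Real.log (c / 2) - Real.log z + Real.log φ * a) - Real.log (θ k) +
        Real.log φ * ((N k : ℝ) - a * ((M + 1 : ℕ) : ℝ)) + δ * ((M + 1 : ℕ) : ℝ) := by
      field_simp
    rw [e3] at h1
    push_cast at h1 ⊢
    linarith
  rw [pow_succ]
  calc z ^ M * z * Real.exp (-(δ * ((M + 1 : ℕ) : ℝ)))
      = z ^ M * (Real.exp (-(δ * ((M + 1 : ℕ) : ℝ))) * z) := by ring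
    _ ≤ z ^ M * (c / θ k * Real.exp (Real.log φ * (N k - a * M)) * (1 / 2)) := by gcongr
    _ = _ := by ring

/-- Single-site sums of the tilted weights at a subcritical fugacity: the occupation numbers from
`A` on contribute a geometric tail of order `1 / θ`. -/
theorem sum_tilted_sizeWeight_le {w : ℕ → ℝ} {A : ℕ} {φ : ℝ} (hφ : 0 ≤ φ) (hφ1 : φ < 1)
    (hw : ∀ n, n < A → 0 < w n) {θ : ℝ} (hθ : 0 < θ) {κ : ℕ} (hκ : κ < A) (h : ℝ) (N : ℕ) :
    ∑ n ∈ Finset.range (N + 1), sizeWeight w A θ n * Real.exp (if n = κ then h else 0) * φ ^ n ≤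
      bulkZ w A φ + (Real.exp h - 1) * (w κ * φ ^ κ) + φ ^ A / (1 - φ) / θ := by
  have hpos := sizeWeight_pos hw hθ
  calc ∑ n ∈ Finset.range (N + 1),
        sizeWeight w A θ n * Real.exp (if n = κ then h else 0) * φ ^ n
      ≤ ∑ n ∈ Finset.range (A + (N + 1)),
        sizeWeight w A θ n * Real.exp (if n = κ then h else 0) * φ ^ n := by
        refine Finset.sum_le_sum_of_subset_of_nonneg
          (Finset.range_subset_range.2 (by omega)) fun n _ _ => ?_
        have := hpos n
        positivity
    _ = ∑ n ∈ Finset.range A, (φ ^ n * w n +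
          if n = κ then (Real.exp h - 1) * (w n * φ ^ n) else 0) +
        ∑ n ∈ Finset.range (N + 1), φ ^ A / θ * φ ^ n := by
        rw [Finset.sum_range_add]
        congr 1
        · refine Finset.sum_congr rfl fun n hn => ?_
          simp only [sizeWeight, Finset.mem_range.1 hn, if_true]
          split_ifs
          · ring
          · rw [Real.exp_zero]
            ring
        · refine Finset.sum_congr rfl fun n _ => ?_
          have h1 : ¬ A + n < A := by omega
          have h2 : A + n ≠ κ := by omega
          simp only [sizeWeight, h1, h2, if_false, Real.exp_zero, pow_add]
          ring
    _ ≤ _ := by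
        rw [Finset.sum_add_distrib, Finset.sum_ite_eq', if_pos (Finset.mem_range.2 hκ),
          ← Finset.mul_sum]
        have hg : ∑ n ∈ Finset.range (N + 1), φ ^ n ≤ (1 - φ)⁻¹ := by
          rw [← tsum_geometric_of_lt_one hφ hφ1]
          exact (summable_geometric_of_lt_one hφ hφ1).sum_le_tsum _ fun n _ => pow_nonneg hφ n
        have h1 : φ ^ A / θ * ∑ n ∈ Finset.range (N + 1), φ ^ n ≤ φ ^ A / θ * (1 - φ)⁻¹ := by
          gcongr
        have h2 : φ ^ A / θ * (1 - φ)⁻¹ = φ ^ A / (1 - φ) / θ := by ring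
        unfold bulkZ
        linarith

/-! ### Equivalence of ensembles -/

/-- Comparison of the upper and lower free energy bounds at a subcritical fugacity. The term
`(ρ - R(φ)) |log φ|` is the free energy cost of the particles that the bulk does not hold. -/
theorem eventually_mul_siteProb_le {w : ℕ → ℝ} {A : ℕ} (hA : 2 ≤ A)
    (hw : ∀ n, n < A → 0 < w n) {φ : ℝ} (hφ : 0 < φ) (hφ1 : φ < 1)
    {L N : ℕ → ℕ} {θ : ℕ → ℝ} {ρ : ℝ} (hρ : 0 < ρ) (hT : ThermodynamicLimit L N θ ρ)
    (hR : bulkDensity w A φ < ρ) {κ : ℕ} (hκ : κ < A) (h : ℝ) {ε : ℝ} (hε : 0 < ε) :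
    ∀ᶠ k in atTop, h * siteProb (sizeWeight w A (θ k)) (L k) (N k) κ ≤
      (Real.exp h - 1) * bulkMass w A φ κ +
        (ρ - bulkDensity w A φ) * (-Real.log φ) + ε := by
  have hz := bulkZ_pos hA hw hφ.le
  set z := bulkZ w A φ with hzdef
  set δ := (ρ - bulkDensity w A φ) * (-Real.log φ) + ε / 2 with hδ
  have hlow := eventually_le_partitionFunction_mul_pow hA hw hφ hφ1 hT hR (δ := δ) (by linarith)
  have htail : Tendsto (fun k => φ ^ A / (1 - φ) / z / θ k) atTop (𝓝 0) :=
    tendsto_const_nhds.div_atTop hT.rate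
  filter_upwards [hlow, htail.eventually (gt_mem_nhds (half_pos hε)),
    hT.rate.eventually_gt_atTop 0, hT.sites.eventually_gt_atTop 0,
    (hT.tendsto_particles hρ).eventually_ge_atTop κ] with k hk htk hθ hL hN
  set v := sizeWeight w A (θ k) with hv
  have hvpos : ∀ n, 0 < v n := sizeWeight_pos hw hθ
  set r := siteProb v (L k) (N k) κ with hr
  set Z := partitionFunction v (Fin (L k)) (N k) with hZ
  set y := (Real.exp h - 1) * bulkMass w A φ κ + φ ^ A / (1 - φ) / z / θ k with hy
  have h1 := exp_mul_siteProb_le hvpos hL hN h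
  have h2 := partitionFunction_mul_pow_le
    (v := fun n => v n * Real.exp (if n = κ then h else 0))
    (fun n => (mul_pos (hvpos n) (Real.exp_pos _)).le) hφ.le (L k) (N k)
  have h3 := sum_tilted_sizeWeight_le hφ.le hφ1 hw hθ hκ h (N k)
  have h4 : bulkZ w A φ + (Real.exp h - 1) * (w κ * φ ^ κ) + φ ^ A / (1 - φ) / θ k ≤
      z * Real.exp y := by
    have e : bulkZ w A φ + (Real.exp h - 1) * (w κ * φ ^ κ) + φ ^ A / (1 - φ) / θ k =
        z * (y + 1) := by
      simp only [hy, bulkMass, ← hzdef]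
      field_simp
      ring
    rw [e]
    exact mul_le_mul_of_nonneg_left (Real.add_one_le_exp y) hz.le
  have h0 : 0 ≤ ∑ n ∈ Finset.range (N k + 1),
      v n * Real.exp (if n = κ then h else 0) * φ ^ n :=
    Finset.sum_nonneg fun n _ => by
      have := hvpos n
      positivity
  have h5 : Real.exp (h * (L k * r)) * (z ^ L k * Real.exp (-(δ * L k))) ≤
      z ^ L k * Real.exp (L k * y) :=
    calc Real.exp (h * (L k * r)) * (z ^ L k * Real.exp (-(δ * L k)))
        ≤ Real.exp (h * (L k * r)) * (Z * φ ^ N k) := by gcongr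
      _ = Real.exp (h * (L k * r)) * Z * φ ^ N k := by ring
      _ ≤ _ := mul_le_mul_of_nonneg_right h1 (by positivity)
      _ ≤ _ := h2
      _ ≤ (z * Real.exp y) ^ L k := pow_le_pow_left₀ h0 (h3.trans h4) _
      _ = _ := by rw [mul_pow, Real.exp_nat_mul]
  have h6 : Real.exp (h * (L k * r) + -(δ * L k)) ≤ Real.exp (L k * y) := by
    have hzL : 0 < z ^ L k := by positivity
    refine le_of_mul_le_mul_left ?_ hzL
    rw [Real.exp_add]
    linarith
  rw [Real.exp_le_exp] at h6
  have hL' : (0 : ℝ) < L k := by exact_mod_cast hL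
  have h7 : h * r ≤ y + δ := by
    refine le_of_mul_le_mul_left ?_ hL'
    linarith
  linarith

/-- The one-site marginals converge to the bulk law at fugacity `φ ≤ 1` if either the bulk holds all
the particles (`R(φ) = ρ`) or the bulk is critical (`φ = 1`). -/
theorem tendsto_siteProb {w : ℕ → ℝ} {A : ℕ} (hA : 2 ≤ A)
    (hw : ∀ n, n < A → 0 < w n) {φ : ℝ} (hφ : 0 < φ) (hφ1 : φ ≤ 1)
    {L N : ℕ → ℕ} {θ : ℕ → ℝ} {ρ : ℝ} (hρ : 0 < ρ) (hT : ThermodynamicLimit L N θ ρ)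
    (hR : bulkDensity w A φ ≤ ρ) (hcrit : (ρ - bulkDensity w A φ) * Real.log φ = 0)
    {κ : ℕ} (hκ : κ < A) :
    Tendsto (fun k => siteProb (sizeWeight w A (θ k)) (L k) (N k) κ) atTop
      (𝓝 (bulkMass w A φ κ)) := by
  set r := fun k => siteProb (sizeWeight w A (θ k)) (L k) (N k) κ with hr
  set ν := bulkMass w A φ κ with hν
  -- The bound at fugacities `ψ < φ` passes to the limit `ψ → φ`.
  have hbound : ∀ h ε : ℝ, 0 < ε → ∀ᶠ k in atTop, h * r k ≤ (Real.exp h - 1) * ν + ε := by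
    intro h ε hε
    have hc : ContinuousAt (fun ψ => (Real.exp h - 1) * bulkMass w A ψ κ +
        (ρ - bulkDensity w A ψ) * (-Real.log ψ)) φ := by
      have h1 := continuousAt_bulkMass hA hw hφ.le κ
      have h2 := continuousAt_bulkDensity hA hw hφ.le
      have h3 := Real.continuousAt_log hφ.ne'
      exact (continuousAt_const.mul h1).add ((continuousAt_const.sub h2).mul h3.neg)
    have hlt : (Real.exp h - 1) * bulkMass w A φ κ +
        (ρ - bulkDensity w A φ) * (-Real.log φ) < (Real.exp h - 1) * ν + ε / 2 := by
      rw [mul_neg, hcrit]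
      linarith
    have hev := (hc.eventually (gt_mem_nhds hlt)).and (lt_mem_nhds hφ)
    obtain ⟨ψ, ⟨hψ, hψ0⟩, hψφ⟩ := ((hev.filter_mono
      (nhdsWithin_le_nhds (s := Set.Iio φ))).and self_mem_nhdsWithin).exists
    have hψφ : ψ < φ := hψφ
    have hRψ : bulkDensity w A ψ < ρ :=
      (strictMonoOn_bulkDensity hA hw hψ0.le hφ.le hψφ).trans_le hR
    filter_upwards [eventually_mul_siteProb_le hA hw hψ0 (hψφ.trans_le hφ1) hρ hT hRψ hκ h
      (half_pos hε)] with k hk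
    linarith
  have hν0 : 0 ≤ ν := bulkMass_nonneg hA hw hφ.le hκ
  rw [Metric.tendsto_nhds]
  intro ε hε
  -- Both signs of `h`, with `|h|` small enough for `exp h - 1 ≤ h + h ^ 2`.
  set h := min 1 (ε / (2 * (ν + 1))) with hh
  have hh0 : 0 < h := lt_min one_pos (by positivity)
  have hh1 : h ≤ 1 := min_le_left _ _
  have hhε : h * (ν + 1) ≤ ε / 2 := by
    have : h ≤ ε / (2 * (ν + 1)) := min_le_right _ _
    rw [le_div_iff₀ (by positivity)] at this
    linarith
  have e1 := (abs_le.1 (Real.abs_exp_sub_one_sub_id_le (x := h) (by rwa [abs_of_pos hh0]))).2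
  have e2 := (abs_le.1 (Real.abs_exp_sub_one_sub_id_le (x := -h)
    (by rwa [abs_neg, abs_of_pos hh0]))).2
  filter_upwards [hbound h (h ^ 2) (by positivity), hbound (-h) (h ^ 2) (by positivity)]
    with k h1 h2
  have hup : h * r k ≤ h * (ν + ε / 2) := by
    have := mul_le_mul_of_nonneg_right e1 hν0
    have := mul_le_mul_of_nonneg_left hhε hh0.le
    linarith
  have hdown : h * (ν - ε / 2) ≤ h * r k := by
    have := mul_le_mul_of_nonneg_right e2 hν0
    have := mul_le_mul_of_nonneg_left hhε hh0.le
    linarith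
  have hup' := le_of_mul_le_mul_left hup hh0
  have hdown' := le_of_mul_le_mul_left hdown hh0
  rw [Real.dist_eq]
  exact (abs_le.2 ⟨by linarith, by linarith⟩ : |r k - ν| ≤ ε / 2).trans_lt (half_lt_self hε)

/-- Convergence of the joint law of `m` sites, by successively conditioning on one site: what remains
is a canonical measure on one site fewer, again in the thermodynamic limit. -/
theorem tendsto_jointProb {w : ℕ → ℝ} {A : ℕ} (hA : 2 ≤ A)
    (hw : ∀ n, n < A → 0 < w n) {φ : ℝ} (hφ : 0 < φ) (hφ1 : φ ≤ 1) {θ : ℕ → ℝ} {ρ : ℝ}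
    (hρ : 0 < ρ) (hR : bulkDensity w A φ ≤ ρ)
    (hcrit : (ρ - bulkDensity w A φ) * Real.log φ = 0) {m : ℕ} (κ : Fin m → ℕ)
    (hκ : ∀ i, κ i < A) {L N : ℕ → ℕ} (hT : ThermodynamicLimit L N θ ρ) :
    Tendsto (fun k => (∏ i, sizeWeight w A (θ k) (κ i)) *
      partitionFunction (sizeWeight w A (θ k)) (Fin (L k - m)) (N k - ∑ i, κ i) /
        partitionFunction (sizeWeight w A (θ k)) (Fin (L k)) (N k)) atTop
      (𝓝 (∏ i, bulkMass w A φ (κ i))) := by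
  induction m generalizing L N with
  | zero =>
    simp only [Finset.univ_eq_empty, Finset.prod_empty, Finset.sum_empty, tsub_zero, one_mul]
    refine tendsto_const_nhds.congr' ?_
    filter_upwards [hT.rate.eventually_gt_atTop 0, hT.sites.eventually_gt_atTop 0] with k hθ hL
    have : Nonempty (Fin (L k)) := ⟨⟨0, hL⟩⟩
    exact (div_self (partitionFunction_pos (sizeWeight_pos hw hθ) _ _).ne').symm
  | succ m ih =>
    have h1 := (tendsto_siteProb hA hw hφ hφ1 hρ hT hR hcrit (hκ 0)).mul
      (ih (fun i => κ i.succ) (fun i => hκ _) (hT.remove_site hρ (κ 0)))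
    rw [Fin.prod_univ_succ]
    refine h1.congr' ?_
    filter_upwards [hT.rate.eventually_gt_atTop 0, hT.sites.eventually_gt_atTop 1] with k hθ hL
    have : Nonempty (Fin (L k - 1)) := ⟨⟨0, by omega⟩⟩
    have hZ := (partitionFunction_pos (sizeWeight_pos hw hθ) (Fin (L k - 1)) (N k - κ 0)).ne'
    rw [siteProb, Fin.prod_univ_succ, Fin.sum_univ_succ, Nat.sub_sub (L k) 1 m, Nat.add_comm 1 m,
      Nat.sub_sub (N k)]
    field_simp

/-! ### From point probabilities to convergence in distribution -/

/-- On a discrete space, convergence of the point masses on a finite set of full limiting mass implies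
weak convergence. -/
theorem tendsto_of_tendsto_singleton {E : Type*} [TopologicalSpace E] [MeasurableSpace E]
    [OpensMeasurableSpace E] [MeasurableSingletonClass E] {P : ℕ → ProbabilityMeasure E}
    {μ : ProbabilityMeasure E} (T : Finset E) (hT : (μ : Measure E) (T : Set E)ᶜ = 0)
    (h : ∀ κ ∈ T, Tendsto (fun k => (P k : Measure E) {κ}) atTop (𝓝 ((μ : Measure E) {κ}))) :
    Tendsto P atTop (𝓝 μ) := by
  classical
  refine tendsto_of_forall_isOpen_le_liminf' fun G _ => ?_
  set F := T.filter (· ∈ G)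
  have hsum : Tendsto (fun k => (P k : Measure E) F) atTop (𝓝 ((μ : Measure E) F)) := by
    simp only [← sum_measure_singleton]
    exact tendsto_finsetSum _ fun κ hκ => h κ (Finset.mem_filter.1 hκ).1
  calc (μ : Measure E) G ≤ (μ : Measure E) (F ∪ (T : Set E)ᶜ) := by
        refine measure_mono fun κ hκ => ?_
        by_cases hκT : κ ∈ T
        · exact Or.inl (Finset.mem_coe.2 (Finset.mem_filter.2 ⟨hκT, hκ⟩))
        · exact Or.inr hκT
    _ ≤ (μ : Measure E) F + (μ : Measure E) (T : Set E)ᶜ := measure_union_le _ _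
    _ = liminf (fun k => (P k : Measure E) F) atTop := by rw [hT, add_zero, hsum.liminf_eq]
    _ ≤ _ := liminf_le_liminf (Eventually.of_forall fun k =>
        measure_mono fun κ hκ => (Finset.mem_filter.1 (Finset.mem_coe.1 hκ)).2)

/-- The joint law of the occupation numbers at `m` distinct sites under the canonical measure. -/
theorem canonicalPMF_toMeasure_sites {v : ℕ → ℝ} (hv : ∀ n, 0 < v n) {Λ : Type*} [Fintype Λ]
    [Nonempty Λ] {N m : ℕ} {x : Fin m → Λ} (hx : Function.Injective x) (κ : Fin m → ℕ)
    (hκ : ∑ i, κ i ≤ N) :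
    (canonicalPMF v hv Λ N).toMeasure {η | ∀ i, η (x i) = κ i} =
      ENNReal.ofReal ((∏ i, v (κ i)) *
        partitionFunction v (Fin (Fintype.card Λ - m)) (N - ∑ i, κ i) /
          partitionFunction v (Fin (Fintype.card Λ)) N) := by
  classical
  have hZ := partitionFunction_pos hv Λ N
  rw [← sum_configs_filter v N hx κ hκ, ← partitionFunction_eq_fin, Finset.sum_div,
    ENNReal.ofReal_sum_of_nonneg fun η _ =>
      div_nonneg (Finset.prod_nonneg fun y _ => (hv _).le) hZ.le,
    PMF.toMeasure_apply_eq_tsum, tsum_eq_sum (s := configs Λ N), Finset.sum_filter]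
  · refine Finset.sum_congr rfl fun η hη => ?_
    simp only [Set.indicator_apply, Set.mem_ofPred_eq]
    congr 1
    simp [canonicalPMF, PMF.ofFinset_apply, hη]
  · intro η hη
    simp [Set.indicator_apply, canonicalPMF, PMF.ofFinset_apply, hη]

theorem bulkPMF_toMeasure_singleton {w : ℕ → ℝ} {A : ℕ} (hA : 2 ≤ A)
    (hw : ∀ n, n < A → 0 < w n) {φ : ℝ} (hφ : 0 ≤ φ) {k : ℕ} (hk : k < A) :
    (bulkPMF w hA hw φ hφ).toMeasure {k} = ENNReal.ofReal (bulkMass w A φ k) := by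
  rw [PMF.toMeasure_apply_singleton _ _ (measurableSet_singleton k)]
  simp [bulkPMF, PMF.ofFinset_apply, hk, bulkMass]

theorem bulkPMF_toMeasure_range {w : ℕ → ℝ} {A : ℕ} (hA : 2 ≤ A)
    (hw : ∀ n, n < A → 0 < w n) {φ : ℝ} (hφ : 0 ≤ φ) :
    (bulkPMF w hA hw φ hφ).toMeasure (Finset.range A) = 1 := by
  rw [PMF.toMeasure_apply_eq_one_iff _ (Finset.measurableSet _)]
  intro k hk
  rw [PMF.mem_support_iff] at hk
  by_contra hkA
  exact hk (by simp_all [bulkPMF, PMF.ofFinset_apply])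

/-- The mean of the bulk law is the bulk density. -/
theorem integral_bulkPMF {w : ℕ → ℝ} {A : ℕ} (hA : 2 ≤ A)
    (hw : ∀ n, n < A → 0 < w n) {φ : ℝ} (hφ : 0 ≤ φ) :
    ∫ n, (n : ℝ) ∂(bulkPMF w hA hw φ hφ).toMeasure = bulkDensity w A φ := by
  have hae : ∀ᵐ n ∂(bulkPMF w hA hw φ hφ).toMeasure, n ∈ (Finset.range A : Set ℕ) :=
    (mem_ae_iff_prob_eq_one (Finset.measurableSet _)).2 (bulkPMF_toMeasure_range hA hw hφ)
  have hint : Integrable (fun n : ℕ => (n : ℝ)) (bulkPMF w hA hw φ hφ).toMeasure := by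
    refine Integrable.of_bound (by fun_prop) A ?_
    filter_upwards [hae] with n hn
    have : n < A := by simpa using hn
    simpa using this.le
  rw [PMF.integral_eq_tsum _ _ hint, tsum_eq_sum (s := Finset.range A), bulkDensity_eq_mean hA]
  · refine Finset.sum_congr rfl fun n hn => ?_
    have hn' := Finset.mem_range.1 hn
    have h0 : 0 ≤ w n * φ ^ n / bulkZ w A φ := bulkMass_nonneg hA hw hφ hn'
    simp [bulkPMF, PMF.ofFinset_apply, hn', bulkMass, ENNReal.toReal_ofReal h0, mul_comm]
  · intro n hn
    have : ¬ n < A := by simpa using hn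
    simp [bulkPMF, PMF.ofFinset_apply, this]

/-- Equivalence of ensembles: convergence of the canonical marginals to the bulk law at a fugacity
`φ ≤ 1` at which the bulk holds all the particles or is critical. -/
theorem sitesTendstoIID_bulkPMF {w : ℕ → ℝ} {A : ℕ} (hA : 2 ≤ A)
    (hw : ∀ n, n < A → 0 < w n) {φ : ℝ} (hφ : 0 < φ) (hφ1 : φ ≤ 1) {ρ : ℝ} (hρ : 0 < ρ)
    (hR : bulkDensity w A φ ≤ ρ) (hcrit : (ρ - bulkDensity w A φ) * Real.log φ = 0)
    {Λ : ℕ → Type*} [∀ k, Fintype (Λ k)] [∀ k, Nonempty (Λ k)] {N : ℕ → ℕ} {θ : ℕ → ℝ}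
    (hθ : ∀ k, 0 < θ k)
    (hT : ThermodynamicLimit (fun k => Fintype.card (Λ k)) N θ ρ)
    {m : ℕ} {x : ∀ k, Fin m → Λ k} (hx : ∀ᶠ k in atTop, Function.Injective (x k)) :
    SitesTendstoIID N (fun k => sizeWeight w A (θ k)) (fun k => sizeWeight_pos hw (hθ k)) x
      (bulkPMF w hA hw φ hφ.le) := by
  have hmeas : ∀ k, Measurable fun (η : Λ k → ℕ) (i : Fin m) => η (x k i) := fun k =>
    measurable_pi_lambda _ fun i => measurable_pi_apply _
  have hid : ∀ μ : Measure (Fin m → ℕ), μ.map (fun ξ i => ξ i) = μ := fun μ => Measure.map_id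
  refine ⟨fun k => (hmeas k).aemeasurable, measurable_id.aemeasurable, ?_⟩
  refine tendsto_of_tendsto_singleton (Fintype.piFinset fun _ => Finset.range A) ?_ fun κ hκ => ?_
  · simp only [ProbabilityMeasure.coe_mk]
    rw [hid, prob_compl_eq_zero_iff (Finset.measurableSet _), Fintype.coe_piFinset, Measure.pi_pi]
    exact Finset.prod_eq_one fun i _ => bulkPMF_toMeasure_range hA hw hφ.le
  · have hκA : ∀ i, κ i < A := fun i => Finset.mem_range.1 (Fintype.mem_piFinset.1 hκ i)
    simp only [ProbabilityMeasure.coe_mk]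
    rw [hid, Measure.pi_singleton,
      Finset.prod_congr rfl fun i _ => bulkPMF_toMeasure_singleton hA hw hφ.le (hκA i),
      ← ENNReal.ofReal_prod_of_nonneg fun i _ => bulkMass_nonneg hA hw hφ.le (hκA i)]
    refine (ENNReal.tendsto_ofReal
      (tendsto_jointProb hA hw hφ hφ1 hρ hR hcrit κ hκA hT)).congr' ?_
    filter_upwards [hx, (hT.tendsto_particles hρ).eventually_ge_atTop (∑ i, κ i)] with k hk hN
    rw [Measure.map_apply (hmeas k) (measurableSet_singleton κ),
      ← canonicalPMF_toMeasure_sites (sizeWeight_pos hw (hθ k)) hk κ hN]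
    congr 1
    ext η
    simp [funext_iff]

/-- A parameter of order `L ^ γ` diverges subexponentially. -/
theorem thermodynamicLimit_of_rpow {θ : ℕ → ℝ} (hθ : ∀ L, 0 < θ L) {γ Θ ρ : ℝ} (hγ : 0 < γ)
    (hΘ : 0 < Θ) (hθlim : Tendsto (fun L : ℕ => θ L / (L : ℝ) ^ γ) atTop (𝓝 Θ)) {L N : ℕ → ℕ}
    (hL : Tendsto L atTop atTop) (hN : Tendsto (fun k => (N k : ℝ) / (L k : ℝ)) atTop (𝓝 ρ)) :
    ThermodynamicLimit L N (fun k => θ (L k)) ρ := by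
  have hcast : Tendsto (fun n : ℕ => (n : ℝ)) atTop atTop := tendsto_natCast_atTop_atTop
  have hrate : Tendsto θ atTop atTop := by
    have h1 := hθlim.pos_mul_atTop hΘ ((tendsto_rpow_atTop hγ).comp hcast)
    refine h1.congr' ?_
    filter_upwards [eventually_gt_atTop 0] with n hn
    have hn' : (0 : ℝ) < n := by exact_mod_cast hn
    have := Real.rpow_pos_of_pos hn' γ
    simp only [Function.comp_apply]
    field_simp
  have hlog : Tendsto (fun n : ℕ => Real.log (θ n) / n) atTop (𝓝 0) := by
    have h1 : Tendsto (fun n : ℕ => Real.log (θ n / (n : ℝ) ^ γ) / n + γ * (Real.log n / n))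
        atTop (𝓝 (0 + γ * 0)) :=
      ((hθlim.log hΘ.ne').div_atTop hcast).add
        ((Real.isLittleO_log_id_atTop.tendsto_div_nhds_zero.comp hcast).const_mul γ)
    rw [mul_zero, add_zero] at h1
    refine h1.congr' ?_
    filter_upwards [eventually_gt_atTop 0] with n hn
    have hn' : (0 : ℝ) < n := by exact_mod_cast hn
    rw [Real.log_div (hθ n).ne' (Real.rpow_pos_of_pos hn' γ).ne', Real.log_rpow hn']
    ring
  exact ⟨hL, hN, hrate.comp hL, hlog.comp hL⟩

end ZRP

theorem theorem1
    (A : ℕ) (hA : 2 ≤ A)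
    (w : ℕ → ℝ) (hw : ∀ n, n < A → 0 < w n)
    (θ : ℕ → ℝ) (hθ : ∀ L, 0 < θ L)
    (γ Θ ρ : ℝ) (hγ : 0 < γ) (hΘ : 0 < Θ) (hρ : 0 < ρ)
    (hθlim : Tendsto (fun L : ℕ => θ L / (L : ℝ) ^ γ) atTop (𝓝 Θ))
    (Λ : ℕ → Type*) [∀ k, Fintype (Λ k)] [∀ k, Nonempty (Λ k)] (N : ℕ → ℕ)
    (hL : Tendsto (fun k => Fintype.card (Λ k)) atTop atTop)
    (hN : Tendsto (fun k => (N k : ℝ) / (Fintype.card (Λ k) : ℝ)) atTop (𝓝 ρ))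
    (m : ℕ) (x : ∀ k, Fin m → Λ k) (hx : ∀ᶠ k in atTop, Function.Injective (x k)) :
    (ρ ≤ ZRP.criticalDensity w A →
      ∃ (φ : ℝ) (hφ : 0 ≤ φ), φ ≤ 1 ∧ ZRP.bulkDensity w A φ = ρ ∧
        (∀ ψ : ℝ, 0 ≤ ψ → ZRP.bulkDensity w A ψ = ρ → ψ = φ) ∧
        ZRP.SitesTendstoIID N (fun k => ZRP.sizeWeight w A (θ (Fintype.card (Λ k))))
          (fun _ => ZRP.sizeWeight_pos hw (hθ _)) x (ZRP.bulkPMF w hA hw φ hφ)) ∧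
    (ZRP.criticalDensity w A ≤ ρ →
      ZRP.SitesTendstoIID N (fun k => ZRP.sizeWeight w A (θ (Fintype.card (Λ k))))
        (fun _ => ZRP.sizeWeight_pos hw (hθ _)) x (ZRP.bulkPMF w hA hw 1 zero_le_one) ∧
      ∫ n, (n : ℝ) ∂(ZRP.bulkPMF w hA hw 1 zero_le_one).toMeasure =
        ZRP.criticalDensity w A) := by
  have hT := ZRP.thermodynamicLimit_of_rpow hθ hγ hΘ hθlim hL hN
  constructor
  · intro hc
    have hcont : ContinuousOn (ZRP.bulkDensity w A) (Set.Icc 0 1) := fun φ hφ =>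
      (ZRP.continuousAt_bulkDensity hA hw hφ.1).continuousWithinAt
    obtain ⟨φ, ⟨hφ0, hφ1⟩, hφ⟩ := intermediate_value_Icc zero_le_one hcont
      (show ρ ∈ Set.Icc _ _ by
        rw [ZRP.bulkDensity_zero hA, ZRP.bulkDensity_one]
        exact ⟨hρ.le, hc⟩)
    have hφpos : 0 < φ := by
      refine lt_of_le_of_ne hφ0 fun h => ?_
      rw [← h, ZRP.bulkDensity_zero hA] at hφ
      exact hρ.ne hφ
    refine ⟨φ, hφ0, hφ1, hφ, fun ψ hψ hψρ => ?_, ?_⟩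
    · exact (ZRP.strictMonoOn_bulkDensity hA hw).injOn hψ hφ0 (hψρ.trans hφ.symm)
    · exact ZRP.sitesTendstoIID_bulkPMF hA hw hφpos hφ1 hρ hφ.le (by rw [hφ, sub_self, zero_mul])
        (fun _ => hθ _) hT hx
  · intro hc
    refine ⟨ZRP.sitesTendstoIID_bulkPMF hA hw one_pos le_rfl hρ ?_ (by simp) (fun _ => hθ _) hT hx,
      ?_⟩
    · rwa [ZRP.bulkDensity_one]
    · rw [ZRP.integral_bulkPMF hA hw zero_le_one, ZRP.bulkDensity_one]
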